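/- Let $n\ge 0$ and let $A\in\mathbb{Q}^{n\times n}$ be expanding, i.e. every complex eigenvalue $\eta$ of $A$ satisfies $|\eta|>1$; put $B=A^{-1}$. For an invertible $M\in\mathbb{Q}^{n\times n}$ let $\mathbb{Z}^n[M]=\sum_{k\ge 0}M^k\mathbb{Z}^n\subset\mathbb{Q}^n$, and let $\mathbb{Z}^n(B)=\sum_{k\in\mathbb{Z}}B^k\mathbb{Z}^n$. Set $b=|\mathbb{Z}^n[B]/B\mathbb{Z}^n[B]|$. For $y\in\mathbb{Z}^n(B)$ let $\nu(y)$ be the integer $k$ with $y\in B^k\mathbb{Z}^n[B]\setminus B^{k+1}\mathbb{Z}^n[B]$, and $\nu(y)=\infty$ if there is no such $k$ (in particular $\nu(0)=\infty$). Let $\mathbb{Z}^n((B))$ be the (Hausdorff) completion of $\mathbb{Z}^n(B)$ with respect to $\mathbf{d}_B(y,y')=b^{-\nu(y-y')}$, where $b^{-\infty}=0$ and points at distance $0$ are identified. Extend $\mathbf{d}_B$ to it, let $\mathbb{Z}^n[[B]]=\{y\in\mathbb{Z}^n((B)) : \mathbf{d}_B(y,0)\le 1\}$, and let $\mu_B$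 be the Haar measure on $\mathbb{Z}^n((B))$ with $\mu_B(\mathbb{Z}^n[[B]])=1$. Let $\mathbb{K}_A=\mathbb{R}^n\times\mathbb{Z}^n((B))$, with the measure $\mu=\lambda\times\mu_B$, where $\lambda$ is Lebesgue measure. The matrix $A$ acts on $\mathbb{K}_A$ by multiplication in both coordinates (extended by continuity in the second), and $\varphi:\mathbb{Z}^n(B)\to\mathbb{K}_A$, $\varphi(x)=(x,x)$, is the diagonal map. Let $\mathcal{D}\subset\mathbb{Z}^n[A]$ be a finite set with $|\mathcal{D}|=|\mathbb{Z}^n[A]/A\mathbb{Z}^n[A]|$, and suppose that $(A,\mathcal{D})$ is a standard digit system, i.e. $\mathcal{D}$ is a complete set of residue class representatives of $\mathbb{Z}^n[A]/A\mathbb{Z}^n[A]$. Then there is a unique nonempty compact set $\mathcal{F}=\mathcal{F}(A,\mathcal{D})\subset\mathbb{K}_A$ with $$A\mathcal{F}=\bigcup_{d\in\mathcal{D}}(\mathcal{F}+\varphi(d)),$$ and $\mu(\mathcal{F})>0$; that is, $\mathcal{F}$ is a rational self-affine tile. -/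

import Mathlib

open MeasureTheory

namespace RationalTile

variable {n : ℕ}

/-- All complex eigenvalues of `A` lie outside the closed unit disk. -/
def IsExpanding (A : Matrix (Fin n) (Fin n) ℚ) : Prop :=
  ∀ z ∈ spectrum ℂ (A.map (algebraMap ℚ ℂ)), 1 < ‖z‖

/-- The group `ℤⁿ`, as a subgroup of `ℚⁿ`. -/
def intLattice (n : ℕ) : AddSubgroup (Fin n → ℚ) :=
  ((Int.castAddHom ℚ).compLeft (Fin n)).range

/-- Multiplication by the matrix `M` on `ℚⁿ`. -/
def mulHom (M : Matrix (Fin n) (Fin n) ℚ) : (Fin n → ℚ) →+ (Fin n → ℚ) :=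
  M.mulVecLin.toAddMonoidHom

/-- The module `ℤⁿ[M]`, the sum of all `M ^ k ℤⁿ` with `k ≥ 0`. -/
def zAdjoin (M : Matrix (Fin n) (Fin n) ℚ) : AddSubgroup (Fin n → ℚ) :=
  ⨆ k : ℕ, (intLattice n).map (mulHom (M ^ k))

/-- The submodule `M ℤⁿ[M]` of `ℤⁿ[M]`. -/
def mulSub (M : Matrix (Fin n) (Fin n) ℚ) : AddSubgroup (zAdjoin M) :=
  ((zAdjoin M).map (mulHom M)).addSubgroupOf (zAdjoin M)

/-- The order of `ℤⁿ[M] / M ℤⁿ[M]`. -/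
noncomputable def residueCard (M : Matrix (Fin n) (Fin n) ℚ) : ℕ :=
  Nat.card (zAdjoin M ⧸ mulSub M)

/-- `(A, D)` is a digit system: `A` is expanding and `D ⊆ ℤⁿ[A]` has as many elements as
`ℤⁿ[A] / A ℤⁿ[A]`. -/
structure IsDigitSystem (A : Matrix (Fin n) (Fin n) ℚ) (D : Finset (zAdjoin A)) : Prop where
  expanding : IsExpanding A
  card_eq : D.card = residueCard A

/-- A digit system is standard if every residue class of `ℤⁿ[A]` modulo `A ℤⁿ[A]` has exactly one
representative in `D`. -/
structure IsStandardDigitSystem (A : Matrix (Fin n) (Fin n) ℚ) (D : Finset (zAdjoin A)) : Prop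
    extends IsDigitSystem A D where
  complete : ∀ c : zAdjoin A ⧸ mulSub A, ∃! d : zAdjoin A, d ∈ D ∧ QuotientAddGroup.mk d = c

/-- The module `ℤⁿ(B) = ℤⁿ(A)`, the sum of all `A ^ k ℤⁿ` with `k ∈ ℤ`. -/
noncomputable def zLaurent (A : Matrix (Fin n) (Fin n) ℚ) : AddSubgroup (Fin n → ℚ) :=
  ⨆ k : ℤ, (intLattice n).map (mulHom (A ^ k))

/-- The module `B ^ k ℤⁿ[B]`, where `B = A⁻¹` and `k ∈ ℤ`. -/
noncomputable def filt (A : Matrix (Fin n) (Fin n) ℚ) (k : ℤ) : AddSubgroup (Fin n → ℚ) :=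
  (zAdjoin A⁻¹).map (mulHom (A⁻¹ ^ k))

/-- `B ^ k ℤⁿ[B]` contains `y` and `B ^ (k + 1) ℤⁿ[B]` does not. -/
def IsJump (A : Matrix (Fin n) (Fin n) ℚ) (y : Fin n → ℚ) (k : ℤ) : Prop :=
  y ∈ filt A k ∧ y ∉ filt A (k + 1)

open Classical in
/-- The `B`-adic valuation. The value is `⊤` at the points of `ℤⁿ(B)` that lie in `B ^ k ℤⁿ[B]`
for every `k`. -/
noncomputable def val (A : Matrix (Fin n) (Fin n) ℚ) (y : Fin n → ℚ) : WithTop ℤ :=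
  if ∃ k, IsJump A y k then ((sInf {k : ℤ | IsJump A y k} : ℤ) : WithTop ℤ) else ⊤

/-- `b ^ (-v)` for `b = |ℤⁿ[B] / B ℤⁿ[B]|`, with the convention `b ^ (-∞) = 0`. -/
noncomputable def expVal (A : Matrix (Fin n) (Fin n) ℚ) : WithTop ℤ → ℝ
  | ⊤ => 0
  | (k : ℤ) => (residueCard A⁻¹ : ℝ) ^ (-k)

/-- `b ^ (-ν(y))`. -/
noncomputable def bAbs (A : Matrix (Fin n) (Fin n) ℚ) (y : Fin n → ℚ) : ℝ :=
  expVal A (val A y)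

/-! Basic facts needed to know that `bAbs` is a seminorm whose unit ball is precompact. -/

theorem mulHom_comp (M N : Matrix (Fin n) (Fin n) ℚ) (x : Fin n → ℚ) :
    mulHom M (mulHom N x) = mulHom (M * N) x := by
  simp [mulHom]

theorem mulHom_one (x : Fin n → ℚ) : mulHom (1 : Matrix (Fin n) (Fin n) ℚ) x = x := by
  simp [mulHom]

theorem IsExpanding.isUnit_det {A : Matrix (Fin n) (Fin n) ℚ} (hA : IsExpanding A) :
    IsUnit A.det := by
  have h0 : (0 : ℂ) ∉ spectrum ℂ (A.map (algebraMap ℚ ℂ)) := by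
    intro h
    have := hA 0 h
    norm_num at this
  rw [spectrum.zero_notMem_iff, Matrix.isUnit_iff_isUnit_det] at h0
  have h1 : (A.map (algebraMap ℚ ℂ)).det = algebraMap ℚ ℂ A.det := by
    rw [RingHom.map_det]; rfl
  rw [h1, isUnit_iff_ne_zero] at h0
  rw [isUnit_iff_ne_zero]
  rintro h
  exact h0 (by rw [h, map_zero])

theorem intLattice_le_zAdjoin (M : Matrix (Fin n) (Fin n) ℚ) : intLattice n ≤ zAdjoin M := by
  intro x hx
  refine AddSubgroup.mem_iSup_of_mem 0 ⟨x, hx, ?_⟩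
  rw [pow_zero, mulHom_one]

theorem map_zAdjoin_le (M : Matrix (Fin n) (Fin n) ℚ) :
    (zAdjoin M).map (mulHom M) ≤ zAdjoin M := by
  rw [zAdjoin, AddSubgroup.map_iSup]
  refine iSup_le fun k => ?_
  rintro _ ⟨_, ⟨x, hx, rfl⟩, rfl⟩
  refine AddSubgroup.mem_iSup_of_mem (k + 1) ⟨x, hx, ?_⟩
  rw [mulHom_comp, pow_succ']

section
variable {A : Matrix (Fin n) (Fin n) ℚ}

theorem isUnit_inv_det (h : IsUnit A.det) : IsUnit (A⁻¹).det :=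
  Matrix.isUnit_nonsing_inv_det A h

theorem filt_zero : filt A 0 = zAdjoin A⁻¹ := by
  ext x
  constructor
  · rintro ⟨y, hy, rfl⟩
    rw [zpow_zero, mulHom_one]
    exact hy
  · intro hx
    exact ⟨x, hx, by rw [zpow_zero, mulHom_one]⟩

theorem map_filt (h : IsUnit A.det) (j k : ℤ) :
    (filt A k).map (mulHom (A⁻¹ ^ j)) = filt A (j + k) := by
  rw [filt, filt, AddSubgroup.map_map]
  congr 1
  refine AddMonoidHom.ext fun x => ?_
  rw [AddMonoidHom.comp_apply, mulHom_comp]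
  rw [Matrix.zpow_add (isUnit_inv_det h)]

theorem filt_succ_le (h : IsUnit A.det) (k : ℤ) : filt A (k + 1) ≤ filt A k := by
  rw [← map_filt h k 1, filt, filt, zpow_one]
  exact AddSubgroup.map_mono (map_zAdjoin_le _)

theorem filt_antitone (h : IsUnit A.det) : Antitone (filt A) :=
  antitone_int_of_succ_le (filt_succ_le h)

theorem exists_mem_filt (h : IsUnit A.det) {y : Fin n → ℚ} (hy : y ∈ zLaurent A) :
    ∃ k, y ∈ filt A k := by
  have hd : Directed (· ≤ ·) fun k : ℤ => filt A (-k) :=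
    Monotone.directed_le fun a b hab => filt_antitone h (by lia)
  have hle : zLaurent A ≤ ⨆ k : ℤ, filt A (-k) := by
    refine iSup_le fun k => ?_
    rintro _ ⟨x, hx, rfl⟩
    refine AddSubgroup.mem_iSup_of_mem k ⟨x, intLattice_le_zAdjoin _ hx, ?_⟩
    rw [Matrix.inv_zpow' h, neg_neg]
  obtain ⟨k, hk⟩ := (AddSubgroup.mem_iSup_of_directed hd).1 (hle hy)
  exact ⟨_, hk⟩

theorem mem_filt_of_no_jump (h : IsUnit A.det) {y : Fin n → ℚ} (hy : y ∈ zLaurent A)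
    (hj : ¬ ∃ k, IsJump A y k) (k : ℤ) : y ∈ filt A k := by
  obtain ⟨m, hm⟩ := exists_mem_filt h hy
  have key : ∀ i : ℕ, y ∈ filt A (m + i) := by
    intro i
    induction i with
    | zero => simpa using hm
    | succ i ih =>
      by_contra hc
      exact hj ⟨m + i, ih, by rwa [add_assoc, ← Nat.cast_succ]⟩
  exact filt_antitone h (show k ≤ m + ((k - m).toNat : ℤ) by lia) (key _)

theorem isJump_unique (h : IsUnit A.det) {y : Fin n → ℚ} {j k : ℤ} (hj : IsJump A y j)
    (hk : IsJump A y k) : j = k := by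
  apply le_antisymm
  · by_contra hc
    exact hk.2 (filt_antitone h (by lia) hj.1)
  · by_contra hc
    exact hj.2 (filt_antitone h (by lia) hk.1)

theorem val_of_isJump (h : IsUnit A.det) {y : Fin n → ℚ} {k : ℤ} (hk : IsJump A y k) :
    val A y = (k : WithTop ℤ) := by
  have hs : {j : ℤ | IsJump A y j} = {k} :=
    Set.eq_singleton_iff_unique_mem.2 ⟨hk, fun j hj => isJump_unique h hj hk⟩
  rw [val, if_pos ⟨k, hk⟩, hs, csInf_singleton]

theorem bAbs_of_isJump (h : IsUnit A.det) {y : Fin n → ℚ} {k : ℤ} (hk : IsJump A y k) :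
    bAbs A y = (residueCard A⁻¹ : ℝ) ^ (-k) := by
  rw [bAbs, val_of_isJump h hk]
  rfl

theorem bAbs_of_no_jump {y : Fin n → ℚ} (hj : ¬ ∃ k, IsJump A y k) : bAbs A y = 0 := by
  rw [bAbs, val, if_neg hj]
  rfl

theorem finite_residue (M : Matrix (Fin n) (Fin n) ℚ) (hM : IsUnit M.det) :
    Finite (zAdjoin M ⧸ mulSub M) := by
  obtain ⟨m, hm0, hm⟩ : ∃ m : ℕ, m ≠ 0 ∧
      ∀ x ∈ intLattice n, m • mulHom M⁻¹ x ∈ intLattice n := by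
    refine ⟨∏ i, ∏ j, (M⁻¹ i j).den, Finset.prod_ne_zero_iff.2 fun i _ =>
      Finset.prod_ne_zero_iff.2 fun j _ => (M⁻¹ i j).den_ne_zero, ?_⟩
    rintro _ ⟨v, rfl⟩
    set m := ∏ i, ∏ j, (M⁻¹ i j).den with hmdef
    have hint : ∀ i j, ∃ z : ℤ, (m : ℚ) * M⁻¹ i j = z := by
      intro i j
      obtain ⟨c, hc⟩ : (M⁻¹ i j).den ∣ m :=
        (Finset.dvd_prod_of_mem _ (Finset.mem_univ j)).trans
          (Finset.dvd_prod_of_mem (fun i => ∏ j, (M⁻¹ i j).den) (Finset.mem_univ i))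
      refine ⟨c * (M⁻¹ i j).num, ?_⟩
      rw [hc]
      push_cast
      rw [mul_comm ((M⁻¹ i j).den : ℚ), mul_assoc, mul_comm ((M⁻¹ i j).den : ℚ),
        Rat.mul_den_eq_num]
    choose z hz using hint
    refine ⟨fun i => ∑ j, z i j * v j, ?_⟩
    ext i
    simp only [mulHom, AddMonoidHom.compLeft_apply, Function.comp, Pi.smul_apply, nsmul_eq_mul,
      LinearMap.toAddMonoidHom_coe, Matrix.mulVecLin_apply, Matrix.mulVec, dotProduct]
    simp only [Int.coe_castAddHom, Int.cast_sum, Int.cast_mul, Finset.mul_sum]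
    refine Finset.sum_congr rfl fun j _ => ?_
    rw [← hz]
    simp [mul_assoc]
  have : NeZero m := ⟨hm0⟩
  let toZ : (Fin n → ℤ) → zAdjoin M := fun v =>
    ⟨(Int.castAddHom ℚ).compLeft (Fin n) v, intLattice_le_zAdjoin M ⟨v, rfl⟩⟩
  have hsmul : ∀ x ∈ intLattice n, m • x ∈ (zAdjoin M).map (mulHom M) := by
    intro x hx
    refine ⟨m • mulHom M⁻¹ x, intLattice_le_zAdjoin M (hm x hx), ?_⟩
    rw [map_nsmul, mulHom_comp, Matrix.mul_nonsing_inv _ hM, mulHom_one]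
  have hsurj : Function.Surjective fun w : Fin n → Fin m =>
      (QuotientAddGroup.mk (toZ fun i => ((w i : ℕ) : ℤ)) : zAdjoin M ⧸ mulSub M) := by
    intro q
    obtain ⟨⟨x, hx⟩, rfl⟩ := QuotientAddGroup.mk_surjective q
    have h1 : ∃ y ∈ intLattice n, x - y ∈ (zAdjoin M).map (mulHom M) := by
      have hx' := hx
      rw [zAdjoin] at hx'
      refine AddSubgroup.iSup_induction _
        (C := fun x => ∃ y ∈ intLattice n, x - y ∈ (zAdjoin M).map (mulHom M)) hx' ?_ ?_ ?_
      · rintro k _ ⟨x, hx, rfl⟩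
        cases k with
        | zero =>
          refine ⟨x, hx, ?_⟩
          rw [pow_zero, mulHom_one, sub_self]
          exact zero_mem _
        | succ k =>
          refine ⟨0, zero_mem _, mulHom (M ^ k) x,
            AddSubgroup.mem_iSup_of_mem k ⟨x, hx, rfl⟩, ?_⟩
          rw [mulHom_comp, pow_succ', sub_zero]
      · exact ⟨0, zero_mem _, by rw [sub_self]; exact zero_mem _⟩
      · rintro x x' ⟨y, hy, hxy⟩ ⟨y', hy', hxy'⟩
        exact ⟨y + y', add_mem hy hy', by
          rw [add_sub_add_comm]; exact add_mem hxy hxy'⟩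
    obtain ⟨_, ⟨v, rfl⟩, hv⟩ := h1
    have hmpos : (0 : ℤ) < m := by exact_mod_cast Nat.pos_of_ne_zero hm0
    refine ⟨fun i => ⟨(v i % m).toNat, by
      have := Int.emod_lt_of_pos (v i) hmpos
      have := Int.emod_nonneg (v i) hmpos.ne'
      lia⟩, ?_⟩
    refine QuotientAddGroup.eq.2 ?_
    change -((Int.castAddHom ℚ).compLeft (Fin n) _) + x ∈ (zAdjoin M).map (mulHom M)
    have h2 := hsmul _ ⟨fun i => v i / m, rfl⟩
    have h3 := add_mem hv h2
    convert h3 using 1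
    ext i
    have h4 := Int.emod_nonneg (v i) hmpos.ne'
    have h5 : (v i : ℚ) = (v i % m : ℤ) + m * (v i / m : ℤ) := by
      exact_mod_cast (Int.emod_add_mul_ediv (v i) m).symm
    have h6 : (m • ((Int.castAddHom ℚ).compLeft (Fin n) fun i => v i / (m : ℤ))) i =
        (m : ℚ) * (v i / (m : ℤ) : ℤ) := by
      rw [Pi.smul_apply, nsmul_eq_mul]
      rfl
    rw [Pi.add_apply, Pi.add_apply, h6]
    simp only [AddMonoidHom.compLeft_apply, Function.comp, Pi.neg_apply,
      Pi.sub_apply, Int.coe_castAddHom, Int.toNat_of_nonneg h4]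
    rw [h5]
    ring
  exact Finite.of_surjective _ hsurj

theorem one_le_residueCard (M : Matrix (Fin n) (Fin n) ℚ) (hM : IsUnit M.det) :
    1 ≤ residueCard M := by
  have := finite_residue M hM
  exact Nat.card_pos

theorem relIndex_filt_one : (filt A 1).relIndex (filt A 0) = residueCard A⁻¹ := by
  rw [filt_zero, filt, zpow_one]
  rfl

theorem relIndex_filt (h : IsUnit A.det) (k : ℤ) :
    (filt A (k + 1)).relIndex (filt A k) = residueCard A⁻¹ := by
  have hinj : Function.Injective (mulHom (A⁻¹ ^ k)) :=
    Matrix.mulVec_injective_of_isUnit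
      ((Matrix.isUnit_iff_isUnit_det _).2 ((isUnit_inv_det h).det_zpow k))
  rw [← map_filt h k 1]
  conv_lhs => rw [← add_zero k, ← map_filt h k 0]
  rw [add_zero, AddSubgroup.relIndex_map_map_of_injective _ _ hinj, relIndex_filt_one]

theorem relIndex_filt_ne_zero (h : IsUnit A.det) (k : ℕ) :
    (filt A (k : ℤ)).relIndex (filt A 0) ≠ 0 := by
  induction k with
  | zero => simp
  | succ k ih =>
    have h1 := AddSubgroup.relIndex_mul_relIndex (filt A ((k : ℤ) + 1)) (filt A k) (filt A 0)
      (filt_succ_le h k) (filt_antitone h (by lia))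
    rw [Nat.cast_succ, ← h1, relIndex_filt h]
    exact mul_ne_zero (Nat.one_le_iff_ne_zero.1 (one_le_residueCard _ (isUnit_inv_det h))) ih

theorem two_le_of_isJump (h : IsUnit A.det) {y : Fin n → ℚ} {k : ℤ} (hk : IsJump A y k) :
    2 ≤ residueCard A⁻¹ := by
  have h1 := one_le_residueCard _ (isUnit_inv_det h)
  by_contra hc
  have h2 := relIndex_filt h k
  rw [show residueCard A⁻¹ = 1 by lia, AddSubgroup.relIndex_eq_one] at h2
  exact hk.2 (h2 hk.1)

theorem bAbs_nonneg (y : Fin n → ℚ) : 0 ≤ bAbs A y := by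
  unfold bAbs
  cases val A y with
  | top => exact le_rfl
  | coe k => exact zpow_nonneg (Nat.cast_nonneg _) _

theorem bAbs_le_iff (h : IsUnit A.det) {y : Fin n → ℚ} (hy : y ∈ zLaurent A) (k : ℤ) :
    bAbs A y ≤ (residueCard A⁻¹ : ℝ) ^ (-k) ↔ y ∈ filt A k := by
  by_cases hj : ∃ m, IsJump A y m
  · obtain ⟨m, hm⟩ := hj
    have hb := two_le_of_isJump h hm
    rw [bAbs_of_isJump h hm, zpow_le_zpow_iff_right₀ (by exact_mod_cast hb), neg_le_neg_iff]
    constructor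
    · intro hkm
      exact filt_antitone h hkm hm.1
    · intro hk
      by_contra hc
      exact hm.2 (filt_antitone h (by lia) hk)
  · rw [bAbs_of_no_jump hj]
    exact ⟨fun _ => mem_filt_of_no_jump h hy hj k, fun _ => zpow_nonneg (Nat.cast_nonneg _) _⟩

theorem bAbs_zero : bAbs A 0 = 0 :=
  bAbs_of_no_jump fun ⟨_, hk⟩ => hk.2 (zero_mem _)

theorem bAbs_neg (y : Fin n → ℚ) : bAbs A (-y) = bAbs A y := by
  have : ∀ k, IsJump A (-y) k ↔ IsJump A y k := fun k => by simp [IsJump]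
  have h2 : IsJump A (-y) = IsJump A y := funext fun k => propext (this k)
  rw [bAbs, bAbs, val, val, h2]

theorem bAbs_add_le_max (h : IsUnit A.det) {x y : Fin n → ℚ} (hx : x ∈ zLaurent A)
    (hy : y ∈ zLaurent A) : bAbs A (x + y) ≤ max (bAbs A x) (bAbs A y) := by
  by_cases hj : ∃ m : ℤ, max (bAbs A x) (bAbs A y) = (residueCard A⁻¹ : ℝ) ^ (-m)
  · obtain ⟨m, hm⟩ := hj
    rw [hm, bAbs_le_iff h (add_mem hx hy)]
    exact add_mem ((bAbs_le_iff h hx m).1 (hm ▸ le_max_left _ _))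
      ((bAbs_le_iff h hy m).1 (hm ▸ le_max_right _ _))
  · have hx' : ¬ ∃ m, IsJump A x m := by
      rintro ⟨m, hm⟩
      by_cases hy' : ∃ m, IsJump A y m
      · obtain ⟨l, hl⟩ := hy'
        rcases max_choice (bAbs A x) (bAbs A y) with hc | hc
        · exact hj ⟨m, hc.trans (bAbs_of_isJump h hm)⟩
        · exact hj ⟨l, hc.trans (bAbs_of_isJump h hl)⟩
      · refine hj ⟨m, ?_⟩
        rw [bAbs_of_no_jump hy', max_eq_left (bAbs_nonneg x), bAbs_of_isJump h hm]
    have hy' : ¬ ∃ m, IsJump A y m := by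
      rintro ⟨m, hm⟩
      refine hj ⟨m, ?_⟩
      rw [bAbs_of_no_jump hx', max_eq_right (bAbs_nonneg y), bAbs_of_isJump h hm]
    rw [bAbs_of_no_jump]
    · exact le_max_of_le_left (bAbs_nonneg x)
    · rintro ⟨m, hm⟩
      exact hm.2 (add_mem (mem_filt_of_no_jump h hx hx' _) (mem_filt_of_no_jump h hy hy' _))

theorem bAbs_le_one_of_lt_two (h : IsUnit A.det) {y : Fin n → ℚ}
    (h2 : bAbs A y < 2) : bAbs A y ≤ 1 := by
  by_cases hj : ∃ m, IsJump A y m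
  · obtain ⟨m, hm⟩ := hj
    have hb : (2 : ℝ) ≤ residueCard A⁻¹ := by exact_mod_cast two_le_of_isJump h hm
    rw [bAbs_of_isJump h hm] at h2 ⊢
    refine zpow_le_one_of_nonpos₀ (by linarith) ?_
    by_contra hc
    have := zpow_le_zpow_right₀ (show (1 : ℝ) ≤ residueCard A⁻¹ by linarith)
      (show (1 : ℤ) ≤ -m by lia)
    rw [zpow_one] at this
    linarith
  · rw [bAbs_of_no_jump hj]
    exact zero_le_one

theorem bAbs_mul (h : IsUnit A.det) (y : Fin n → ℚ) :
    bAbs A (mulHom A y) = residueCard A⁻¹ * bAbs A y := by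
  have hmem : ∀ k, mulHom A y ∈ filt A k ↔ y ∈ filt A (k + 1) := by
    intro k
    have h1 : (filt A (k + 1)).map (mulHom (A⁻¹ ^ (-1 : ℤ))) = filt A k := by
      rw [map_filt h]; congr 1; ring
    have h2 : A⁻¹ ^ (-1 : ℤ) = A := by
      rw [Matrix.inv_zpow' h, neg_neg, zpow_one]
    rw [h2] at h1
    have hinj : Function.Injective (mulHom A) :=
      Matrix.mulVec_injective_of_isUnit ((Matrix.isUnit_iff_isUnit_det _).2 h)
    rw [← h1, AddSubgroup.mem_map_iff_mem hinj]
  have hJ : ∀ k, IsJump A (mulHom A y) k ↔ IsJump A y (k + 1) := fun k => by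
    rw [IsJump, IsJump, hmem, hmem]
  by_cases hj : ∃ m, IsJump A y m
  · obtain ⟨m, hm⟩ := hj
    have hb := two_le_of_isJump h hm
    have hb0 : (residueCard A⁻¹ : ℝ) ≠ 0 := by
      have : residueCard A⁻¹ ≠ 0 := by lia
      exact_mod_cast this
    rw [bAbs_of_isJump h hm, bAbs_of_isJump h ((hJ (m - 1)).2 (by simpa using hm)),
      ← zpow_one_add₀ hb0]
    congr 1
    ring
  · rw [bAbs_of_no_jump hj, bAbs_of_no_jump, mul_zero]
    rintro ⟨m, hm⟩
    exact hj ⟨_, (hJ m).1 hm⟩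

end

/-- `ℤⁿ(B)`, to be equipped with the `B`-adic metric (and not with the one of `ℚⁿ`). -/
def Laurent (A : Matrix (Fin n) (Fin n) ℚ) (_hA : IsExpanding A) : Type := zLaurent A

section
variable (A : Matrix (Fin n) (Fin n) ℚ) (hA : IsExpanding A)

noncomputable instance : AddCommGroup (Laurent A hA) :=
  inferInstanceAs (AddCommGroup (zLaurent A))

/-- The function `y ↦ b ^ (-ν(y))` on `ℤⁿ(B)`. -/
noncomputable def bSeminorm : AddGroupSeminorm (Laurent A hA) where
  toFun y := bAbs A y.1
  map_zero' := bAbs_zero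
  add_le' x y := (bAbs_add_le_max hA.isUnit_det x.2 y.2).trans
    (max_le_add_of_nonneg (bAbs_nonneg _) (bAbs_nonneg _))
  neg' y := bAbs_neg y.1

/-- The `B`-adic metric `d(y, y') = b ^ (-ν(y - y'))` on `ℤⁿ(B)`. -/
noncomputable instance : SeminormedAddCommGroup (Laurent A hA) :=
  (bSeminorm A hA).toSeminormedAddCommGroup

theorem norm_def (y : Laurent A hA) : ‖y‖ = bAbs A y.1 := rfl

theorem dist_def (y y' : Laurent A hA) : dist y y' = expVal A (val A (y.1 - y'.1)) := by
  rw [dist_eq_norm, norm_def]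
  rfl

/-- The space `ℤⁿ((B))` of `B`-adic series: the completion of `ℤⁿ(B)` for the `B`-adic metric
(points at distance `0` are identified). -/
abbrev BSeries : Type := UniformSpace.Completion (Laurent A hA)

noncomputable instance : MeasurableSpace (BSeries A hA) := borel _

instance : BorelSpace (BSeries A hA) := ⟨rfl⟩

theorem mulHom_mem_zLaurent (h : IsUnit A.det) {y : Fin n → ℚ} (hy : y ∈ zLaurent A) :
    mulHom A y ∈ zLaurent A := by
  have : (zLaurent A).map (mulHom A) ≤ zLaurent A := by
    rw [zLaurent, AddSubgroup.map_iSup]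
    refine iSup_le fun k => ?_
    rintro _ ⟨_, ⟨x, hx, rfl⟩, rfl⟩
    refine AddSubgroup.mem_iSup_of_mem (1 + k) ⟨x, hx, ?_⟩
    rw [mulHom_comp, Matrix.zpow_one_add h]
  exact this ⟨y, hy, rfl⟩

/-- Multiplication by `A` on `ℤⁿ(B)`. -/
noncomputable def laurentMul : Laurent A hA →+ Laurent A hA where
  toFun y := ⟨mulHom A y.1, mulHom_mem_zLaurent A hA.isUnit_det y.2⟩
  map_zero' := Subtype.ext (map_zero (mulHom A))
  map_add' x y := Subtype.ext (map_add (mulHom A) x.1 y.1)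

theorem laurentMul_continuous : Continuous (laurentMul A hA) :=
  AddMonoidHomClass.continuous_of_bound (laurentMul A hA) (residueCard A⁻¹ : ℝ) fun y =>
    (bAbs_mul hA.isUnit_det y.1).le

/-- Multiplication by `A` on `ℤⁿ((B))`, extended by continuity. -/
noncomputable def seriesMul : BSeries A hA →+ BSeries A hA :=
  (laurentMul A hA).completion (laurentMul_continuous A hA)

/-- The set `ℤⁿ[[B]]` of all `y ∈ ℤⁿ((B))` with `ν(y) ≥ 0`, that is, `b ^ (-ν(y)) ≤ 1`. -/
def integralSeries : Set (BSeries A hA) := {y | ‖y‖ ≤ 1}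

theorem integralSeries_isClosed : IsClosed (integralSeries A hA) :=
  isClosed_le continuous_norm continuous_const

theorem laurent_unitBall_totallyBounded : TotallyBounded {y : Laurent A hA | ‖y‖ ≤ 1} := by
  have h := hA.isUnit_det
  rw [Metric.totallyBounded_iff]
  intro ε hε
  obtain ⟨k, hk⟩ : ∃ k : ℕ, ∀ y ∈ zLaurent A, y ∈ filt A k → bAbs A y < ε := by
    by_cases hb : 2 ≤ residueCard A⁻¹
    · obtain ⟨k, hk⟩ := exists_pow_lt_of_lt_one hε
        (inv_lt_one_of_one_lt₀ (show (1 : ℝ) < residueCard A⁻¹ by exact_mod_cast hb))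
      refine ⟨k, fun y hy hyk => ((bAbs_le_iff h hy k).2 hyk).trans_lt ?_⟩
      rwa [zpow_neg, zpow_natCast, ← inv_pow]
    · refine ⟨0, fun y _ _ => ?_⟩
      rw [bAbs_of_no_jump]
      · exact hε
      · rintro ⟨m, hm⟩
        exact hb (two_le_of_isJump h hm)
  have hfin : Finite (filt A 0 ⧸ (filt A (k : ℤ)).addSubgroupOf (filt A 0)) :=
    Nat.finite_of_card_ne_zero (relIndex_filt_ne_zero h k)
  have hle : filt A 0 ≤ zLaurent A := by
    rw [filt_zero]
    refine iSup_le fun j => ?_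
    rintro _ ⟨x, hx, rfl⟩
    refine AddSubgroup.mem_iSup_of_mem (-(j : ℤ)) ⟨x, hx, ?_⟩
    rw [← Matrix.inv_zpow' h, zpow_natCast]
  let f : filt A 0 ⧸ (filt A (k : ℤ)).addSubgroupOf (filt A 0) → Laurent A hA := fun q =>
    ⟨(Quotient.out q).1, hle (Quotient.out q).2⟩
  refine ⟨Set.range f, Set.finite_range f, ?_⟩
  intro y hy
  have hy0 : y.1 ∈ filt A 0 := by
    rw [← bAbs_le_iff h y.2, neg_zero, zpow_zero]
    exact hy
  set q : filt A 0 ⧸ (filt A (k : ℤ)).addSubgroupOf (filt A 0) :=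
    QuotientAddGroup.mk ⟨y.1, hy0⟩ with hq
  have h1 : (QuotientAddGroup.mk (Quotient.out q) :
      filt A 0 ⧸ (filt A (k : ℤ)).addSubgroupOf (filt A 0)) = QuotientAddGroup.mk ⟨y.1, hy0⟩ :=
    Quotient.out_eq q
  have h2 : -(Quotient.out q).1 + y.1 ∈ filt A (k : ℤ) := by
    have h3 := QuotientAddGroup.eq.1 h1
    exact h3
  refine Set.mem_iUnion₂.2 ⟨f q, ⟨q, rfl⟩, ?_⟩
  rw [mem_ball_iff_norm, norm_def]
  refine hk _ (y - f q).2 ?_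
  change y.1 - (Quotient.out q).1 ∈ _
  rwa [sub_eq_neg_add]

theorem integralSeries_isCompact : IsCompact (integralSeries A hA) := by
  refine TotallyBounded.isCompact_of_isClosed ?_ (integralSeries_isClosed A hA)
  refine (((laurent_unitBall_totallyBounded A hA).image
    (UniformSpace.Completion.uniformContinuous_coe _)).closure).subset ?_
  intro y hy
  rw [Metric.mem_closure_iff]
  intro ε hε
  have hd : DenseRange ((↑) : Laurent A hA → BSeries A hA) :=
    UniformSpace.Completion.denseRange_coe
  obtain ⟨x, hx⟩ := hd.exists_dist_lt y (lt_min hε zero_lt_one)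
  refine ⟨x, ⟨x, ?_, rfl⟩, hx.trans_le (min_le_left _ _)⟩
  have h1 : ‖(x : BSeries A hA)‖ < 2 := by
    have h2 : ‖(x : BSeries A hA)‖ ≤ ‖y‖ + ‖(x : BSeries A hA) - y‖ := norm_le_insert' _ _
    have h3 := hx.trans_le (min_le_right _ _)
    rw [dist_comm, dist_eq_norm] at h3
    have h4 : ‖y‖ ≤ 1 := hy
    linarith
  rw [UniformSpace.Completion.norm_coe] at h1
  exact bAbs_le_one_of_lt_two hA.isUnit_det h1

/-- `ℤⁿ[[B]]` as a compact set with nonempty interior. -/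
def integralCompacts : TopologicalSpace.PositiveCompacts (BSeries A hA) where
  carrier := integralSeries A hA
  isCompact' := integralSeries_isCompact A hA
  interior_nonempty' := by
    refine ⟨0, mem_interior_iff_mem_nhds.2 ?_⟩
    refine Filter.mem_of_superset (Metric.closedBall_mem_nhds (0 : BSeries A hA) one_pos) ?_
    intro y hy
    exact mem_closedBall_zero_iff.1 hy

/-- The `B`-adic measure: the Haar measure on `ℤⁿ((B))` for which `ℤⁿ[[B]]` has measure `1`. -/
noncomputable def seriesMeasure : Measure (BSeries A hA) :=
  Measure.addHaarMeasure (integralCompacts A hA)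

/-- The representation space `ℝⁿ × ℤⁿ((B))`. -/
abbrev RepSpace : Type := EuclideanSpace ℝ (Fin n) × BSeries A hA

/-- The product of the Lebesgue measure and the `B`-adic measure. -/
noncomputable def repMeasure : Measure (RepSpace A hA) :=
  (volume : Measure (EuclideanSpace ℝ (Fin n))).prod (seriesMeasure A hA)

/-- Multiplication by `A` on the representation space. -/
noncomputable def repMul (p : RepSpace A hA) : RepSpace A hA :=
  (Matrix.toEuclideanLin (A.map (algebraMap ℚ ℝ)) p.1, seriesMul A hA p.2)

/-- The diagonal embedding `x ↦ (x, x)` of `ℤⁿ(B)`. -/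
noncomputable def diagEmb (x : Laurent A hA) : RepSpace A hA :=
  (WithLp.toLp 2 fun i => ((x.1 i : ℚ) : ℝ), (x : BSeries A hA))

theorem zAdjoin_le_zLaurent : zAdjoin A ≤ zLaurent A :=
  iSup_le fun k => by
    have := le_iSup (fun k : ℤ => (intLattice n).map (mulHom (A ^ k))) (k : ℤ)
    rwa [zpow_natCast] at this

/-- The image of a digit under the diagonal embedding. -/
noncomputable def digitEmb (d : zAdjoin A) : RepSpace A hA :=
  diagEmb A hA ⟨d.1, zAdjoin_le_zLaurent A d.2⟩

/-- `F` is a nonempty compact subset of the representation space that satisfies the set equation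
`A F = ⋃ d ∈ D, (F + φ(d))`. -/
structure IsSelfAffineSet (D : Finset (zAdjoin A)) (F : Set (RepSpace A hA)) : Prop where
  nonempty : F.Nonempty
  isCompact : IsCompact F
  set_eq : repMul A hA '' F = ⋃ d ∈ D, (fun p => p + digitEmb A hA d) '' F

end

end RationalTile

/-! Some power of `A⁻¹` contracts `ℝⁿ × ℤⁿ((B))`: on `ℝⁿ` because the eigenvalues of `A` lie outside
the unit disc, on `ℤⁿ((B))` because multiplication by `B` divides the `B`-adic metric by `b ≥ 2`
(every element has norm `0` when `b = 1`). Hence an iterate of the Hutchinson operator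
`F ↦ A⁻¹ (F + φ(D))` contracts the nonempty compact sets in the Hausdorff metric, and its unique
fixed point is the tile.

The group `Λ = φ(ℤⁿ[A])` is relatively dense. It is also closed, because it is discrete: a point of
`Λ` with `B`-adic norm at most `1` comes from `ℤⁿ[A] ∩ ℤⁿ[B]`, which is finitely generated since
`ℤ` is Noetherian, and a finitely generated subgroup of `ℚⁿ` has bounded denominators. As `D` meets
all residue classes, `F + Λ` is invariant under `A⁻¹`. Being also relatively dense it is dense, and
being closed it is everything. So countably many translates of `F` cover the space, and
`μ(F) > 0`.
-/

namespace RationalTile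

open Filter Metric TopologicalSpace Topology
open scoped ENNReal NNReal Pointwise

section Hutchinson

theorem hausdorffEDist_image_le {α β : Type*} [PseudoEMetricSpace α] [PseudoEMetricSpace β]
    {K : ℝ≥0} {f : α → β} (hf : LipschitzWith K f) (s t : NonemptyCompacts α) :
    hausdorffEDist (f '' s) (f '' t) ≤ K * hausdorffEDist (s : Set α) t := by
  have exists_near (u v : NonemptyCompacts α) : ∀ y ∈ f '' u, ∃ z ∈ f '' v,
      edist y z ≤ K * hausdorffEDist (u : Set α) v := by
    rintro _ ⟨x, hx, rfl⟩
    obtain ⟨z, hz, hxz⟩ := v.isCompact.exists_infEDist_eq_edist v.nonempty x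
    refine ⟨f z, ⟨z, hz, rfl⟩, (hf x z).trans ?_⟩
    gcongr
    exact hxz.symm.trans_le (infEDist_le_hausdorffEDist_of_mem hx)
  refine hausdorffEDist_le_of_mem_edist (exists_near s t) ?_
  rw [hausdorffEDist_comm]
  exact exists_near t s

theorem hausdorffEDist_add_right_le {E : Type*} [SeminormedAddCommGroup E] (s t u : Set E) :
    hausdorffEDist (s + u) (t + u) ≤ hausdorffEDist s t := by
  rw [← Set.iUnion_add_right_image, ← Set.iUnion_add_right_image]
  refine hausdorffEDist_iUnion_le.trans <| iSup_le fun a =>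
    hausdorffEDist_iUnion_le.trans <| iSup_le fun _ => ?_
  exact (hausdorffEDist_image (isometry_add_right a)).le

variable {E : Type*} [NormedAddCommGroup E]

/-- The Hutchinson operator `F ↦ ⋃ d ∈ D, T (F + d)` of an additive map `T` and a digit set `D`. -/
def hutchinson (T : E →+ E) (hT : Continuous T) (D F : NonemptyCompacts E) :
    NonemptyCompacts E where
  carrier := T '' (F + D)
  isCompact' := (F.isCompact.add D.isCompact).image hT
  nonempty' := (F.nonempty.add D.nonempty).image T

theorem exists_hutchinson_iterate_eq (T : E →+ E) (hT : Continuous T) (D : NonemptyCompacts E)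
    (k : ℕ) : ∃ S : Set E, ∀ F, ((hutchinson T hT D)^[k] F : Set E) = T^[k] '' F + S := by
  induction k with
  | zero => exact ⟨0, fun F => by simp⟩
  | succ k ih =>
    obtain ⟨S, hS⟩ := ih
    refine ⟨T '' (S + D), fun F => ?_⟩
    calc ((hutchinson T hT D)^[k + 1] F : Set E)
        = T '' ((hutchinson T hT D)^[k] F + D) := by rw [Function.iterate_succ_apply']; rfl
      _ = T '' (T^[k] '' F + (S + D)) := by rw [hS, add_assoc]
      _ = T^[k + 1] '' F + T '' (S + D) := by
        rw [Set.image_add, Function.iterate_succ', Set.image_comp]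

theorem contractingWith_hutchinson_iterate {T : E →+ E} (hT : Continuous T) {K : ℝ≥0} {k : ℕ}
    (hK : ContractingWith K T^[k]) (D : NonemptyCompacts E) :
    ContractingWith K (hutchinson T hT D)^[k] := by
  obtain ⟨S, hS⟩ := exists_hutchinson_iterate_eq T hT D k
  refine ⟨hK.1, fun F G => ?_⟩
  calc hausdorffEDist ((hutchinson T hT D)^[k] F : Set E) ((hutchinson T hT D)^[k] G)
      = hausdorffEDist (T^[k] '' F + S) (T^[k] '' G + S) := by rw [hS, hS]
    _ ≤ hausdorffEDist (T^[k] '' F) (T^[k] '' G) := hausdorffEDist_add_right_le _ _ _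
    _ ≤ K * hausdorffEDist (F : Set E) G := hausdorffEDist_image_le hK.2 _ _

theorem existsUnique_image_eq_add [CompleteSpace E] (e : E ≃+ E) (he : Continuous e.symm)
    {K : ℝ≥0} {k : ℕ} (hK : ContractingWith K e.symm^[k]) (D : NonemptyCompacts E) :
    ∃! F : NonemptyCompacts E, e '' F = (F + D : Set E) := by
  let H := hutchinson e.symm.toAddMonoidHom he D
  have isFixedPt_iff (F : NonemptyCompacts E) :
      Function.IsFixedPt H F ↔ e '' F = (F + D : Set E) := by
    rw [Function.IsFixedPt, ← SetLike.coe_set_eq, eq_comm (a := e '' F)]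
    exact (e.toEquiv.eq_image_iff_symm_image_eq F (F + D : Set E)).symm
  have hH : ContractingWith K H^[k] := contractingWith_hutchinson_iterate he hK D
  refine ⟨_, (isFixedPt_iff _).1 hH.isFixedPt_fixedPoint_iterate, fun F hF => ?_⟩
  exact hH.fixedPoint_unique (((isFixedPt_iff F).2 hF).iterate k)

end Hutchinson

section Cover

theorem dense_of_mapsTo_of_contractingWith {X : Type*} [MetricSpace X] {g : X → X} {K : ℝ≥0}
    (hK : ContractingWith K g) (hsurj : Function.Surjective g) {C : Set X} (hC : Set.MapsTo g C C)
    {R : ℝ} (hR : ∀ p, ∃ c ∈ C, dist p c ≤ R) : Dense C := by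
  have exists_near (k : ℕ) (p : X) : ∃ c ∈ C, dist p c ≤ K ^ k * R := by
    induction k generalizing p with
    | zero => simpa using hR p
    | succ k ih =>
      obtain ⟨q, rfl⟩ := hsurj p
      obtain ⟨c, hc, hqc⟩ := ih q
      refine ⟨g c, hC hc, (hK.2.dist_le_mul q c).trans ?_⟩
      rw [pow_succ', mul_assoc]
      gcongr
  have tendsto_bound : Filter.Tendsto (fun k : ℕ => (K : ℝ) ^ k * R) Filter.atTop (nhds 0) := by
    simpa using (tendsto_pow_atTop_nhds_zero_of_lt_one K.2 hK.1).mul_const R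
  refine fun p => Metric.mem_closure_iff.2 fun ε hε => ?_
  obtain ⟨k, hk⟩ := (tendsto_bound.eventually_lt_const hε).exists
  obtain ⟨c, hc, hpc⟩ := exists_near k p
  exact ⟨c, hc, hpc.trans_lt hk⟩

theorem add_eq_univ_of_image_eq_add {E : Type*} [NormedAddCommGroup E] (e : E ≃+ E) {K : ℝ≥0}
    {k : ℕ} (hK : ContractingWith K e.symm^[k]) {F D Λ : Set E} (hF : IsCompact F)
    (hne : F.Nonempty) (heF : e '' F = F + D) (hΛ : IsClosed Λ) (hΛD : Λ ⊆ D + e '' Λ) {R : ℝ}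
    (hR : ∀ p, ∃ x ∈ Λ, dist p x ≤ R) : F + Λ = Set.univ := by
  have subset_image : F + Λ ⊆ e '' (F + Λ) :=
    calc F + Λ ⊆ F + (D + e '' Λ) := Set.add_subset_add_left hΛD
      _ = e '' (F + Λ) := by rw [← add_assoc, ← heF, Set.image_add]
  have mapsTo : Set.MapsTo e.symm (F + Λ) (F + Λ) := fun p hp => by
    obtain ⟨q, hq, rfl⟩ := subset_image hp
    rwa [e.symm_apply_apply]
  obtain ⟨f, hf⟩ := hne
  have near (p : E) : ∃ c ∈ F + Λ, dist p c ≤ R := by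
    obtain ⟨x, hx, hpx⟩ := hR (p - f)
    refine ⟨f + x, Set.add_mem_add hf hx, ?_⟩
    rwa [dist_eq_norm, ← sub_sub, ← dist_eq_norm]
  have dense : Dense (F + Λ) := dense_of_mapsTo_of_contractingWith hK
    (e.symm.surjective.iterate k) (mapsTo.iterate k) near
  rw [← (hΛ.add_left_of_isCompact hF).closure_eq, dense.closure_eq]

theorem measure_pos_of_add_eq_univ {G : Type*} [AddGroup G] [MeasurableSpace G] [MeasurableAdd G]
    {μ : Measure G} [μ.IsAddRightInvariant] [NeZero μ] {F Λ : Set G} (hΛ : Λ.Countable)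
    (hcover : F + Λ = Set.univ) : 0 < μ F := by
  rw [pos_iff_ne_zero]
  intro hF
  refine NeZero.ne μ (Measure.measure_univ_eq_zero.1 ?_)
  rw [← hcover, ← Set.iUnion_add_right_image, measure_biUnion_null_iff hΛ]
  intro x _
  rw [Set.image_add_right, measure_preimage_add_right, hF]

end Cover

section Noetherian

variable {R V : Type*} [Ring R] [AddCommGroup V] [Module R V]

/-- The submodule `G + a G + ⋯ + a ^ k G`. -/
def orbitSum (a : Module.End R V) (G : Submodule R V) (k : ℕ) : Submodule R V :=
  partialSups (fun j => G.map (a ^ j)) k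

theorem orbitSum_succ (a : Module.End R V) (G : Submodule R V) (k : ℕ) :
    orbitSum a G (k + 1) = orbitSum a G k ⊔ G.map (a ^ (k + 1)) :=
  partialSups_add_one _ k

theorem orbitSum_mono (a : Module.End R V) (G : Submodule R V) : Monotone (orbitSum a G) :=
  (partialSups fun j => G.map (a ^ j)).monotone

theorem map_pow_le_orbitSum (a : Module.End R V) (G : Submodule R V) {j k : ℕ} (h : j ≤ k) :
    G.map (a ^ j) ≤ orbitSum a G k :=
  le_partialSups_of_le (fun j => G.map (a ^ j)) h

theorem orbitSum_fg {a : Module.End R V} {G : Submodule R V} (hG : G.FG) (k : ℕ) :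
    (orbitSum a G k).FG := by
  induction k with
  | zero => exact hG.map _
  | succ k ih =>
    rw [orbitSum_succ]
    exact ih.sup (hG.map _)

theorem apply_mem_orbitSum {a : Module.End R V} {G : Submodule R V} {k : ℕ} {x : V}
    (hx : x ∈ orbitSum a G k) : a x ∈ orbitSum a G (k + 1) := by
  suffices h : orbitSum a G k ≤ (orbitSum a G (k + 1)).comap a from h hx
  refine partialSups_le _ _ _ fun j hj => ?_
  rintro _ ⟨g, hg, rfl⟩
  refine map_pow_le_orbitSum a G (Nat.succ_le_succ hj) ⟨g, hg, ?_⟩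
  rw [pow_succ', Module.End.mul_apply]

theorem pow_apply_mem_orbitSum {a : Module.End R V} {G : Submodule R V} {k : ℕ} {x : V}
    (hx : x ∈ orbitSum a G k) (i : ℕ) : (a ^ i) x ∈ orbitSum a G (k + i) := by
  induction i with
  | zero => exact hx
  | succ i ih =>
    rw [pow_succ', Module.End.mul_apply]
    exact apply_mem_orbitSum ih

/- The elements `g` of `G` with `a ^ (k + 1) g ∈ G + ⋯ + a ^ k G` form an ascending chain of
submodules of `G`. -/
theorem exists_forall_mem_orbitSum_of_apply_mem (a : Module.End R V) (G : Submodule R V)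
    [IsNoetherian R G] : ∃ m, ∀ k ≥ m, ∀ x ∈ orbitSum a G (k + 1),
      a x ∈ orbitSum a G (k + 1) → x ∈ orbitSum a G k := by
  let relations : ℕ →o Submodule R G :=
    { toFun := fun k => (orbitSum a G k).comap ((a ^ (k + 1)) ∘ₗ G.subtype)
      monotone' := monotone_nat_of_le_succ fun k g hg => by
        rw [Submodule.mem_comap, LinearMap.comp_apply] at hg ⊢
        rw [pow_succ', Module.End.mul_apply]
        exact apply_mem_orbitSum hg }
  obtain ⟨m, hm⟩ := monotone_stabilizes_iff_noetherian.2 ‹_› relations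
  refine ⟨m, fun k hk x hx hax => ?_⟩
  rw [orbitSum_succ] at hx
  obtain ⟨y, hy, _, ⟨g, hg, rfl⟩, rfl⟩ := Submodule.mem_sup.1 hx
  have relation_succ : (⟨g, hg⟩ : G) ∈ relations (k + 1) := by
    have := sub_mem hax (apply_mem_orbitSum hy)
    rwa [map_add, add_sub_cancel_left, ← Module.End.mul_apply, ← pow_succ'] at this
  rw [← hm (k + 1) (hk.trans k.le_succ), hm k hk] at relation_succ
  exact add_mem hy relation_succ

theorem exists_forall_mem_orbitSum_of_pow_apply_mem (a : Module.End R V) (G : Submodule R V)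
    [IsNoetherian R G] : ∃ m, ∀ i l, ∀ x ∈ orbitSum a G l,
      (a ^ i) x ∈ orbitSum a G (m + i) → x ∈ orbitSum a G m := by
  obtain ⟨m, hm⟩ := exists_forall_mem_orbitSum_of_apply_mem a G
  have descend (k l : ℕ) (hk : m ≤ k) (x : V) (hx : x ∈ orbitSum a G (k + l))
      (hax : a x ∈ orbitSum a G (k + 1)) : x ∈ orbitSum a G k := by
    induction l with
    | zero => exact hx
    | succ l ih =>
      exact ih (hm (k + l) (by lia) x hx (orbitSum_mono a G (by lia) hax))
  refine ⟨m, fun i => ?_⟩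
  induction i with
  | zero => exact fun l x _ hx => hx
  | succ i ih =>
    refine fun l x hx hax => ih l x hx (descend _ (l + i) (by lia) _ ?_ ?_)
    · exact orbitSum_mono a G (by lia) (pow_apply_mem_orbitSum hx i)
    · rwa [← Module.End.mul_apply, ← pow_succ']

theorem pow_apply_mem_orbitSum_of_mul_eq_one {a b : Module.End R V} (hab : a * b = 1)
    {G : Submodule R V} {k : ℕ} {x : V} (hx : x ∈ orbitSum b G k) :
    (a ^ k) x ∈ orbitSum a G k := by
  suffices h : orbitSum b G k ≤ (orbitSum a G k).comap (a ^ k) from h hx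
  refine partialSups_le _ _ _ fun j hj => ?_
  rintro _ ⟨g, hg, rfl⟩
  refine map_pow_le_orbitSum a G (k.sub_le j) ⟨g, hg, ?_⟩
  rw [← Module.End.mul_apply, ← Nat.sub_add_cancel hj, pow_add, mul_assoc,
    pow_mul_pow_eq_one j hab, mul_one, Nat.add_sub_cancel]

theorem exists_iSup_inf_iSup_le_orbitSum {a b : Module.End R V} (hab : a * b = 1)
    (G : Submodule R V) [IsNoetherian R G] :
    ∃ m, (⨆ k : ℕ, G.map (a ^ k)) ⊓ (⨆ k : ℕ, G.map (b ^ k)) ≤ orbitSum a G m := by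
  obtain ⟨m, hm⟩ := exists_forall_mem_orbitSum_of_pow_apply_mem a G
  refine ⟨m, fun x ⟨hxa, hxb⟩ => ?_⟩
  rw [← iSup_partialSups_eq] at hxa hxb
  obtain ⟨l, hl⟩ := (Submodule.mem_iSup_of_directed _ (orbitSum_mono a G).directed_le).1 hxa
  obtain ⟨k, hk⟩ := (Submodule.mem_iSup_of_directed _ (orbitSum_mono b G).directed_le).1 hxb
  exact hm k l x hl (orbitSum_mono a G (Nat.le_add_left k m)
    (pow_apply_mem_orbitSum_of_mul_eq_one hab hk))

end Noetherian

section Discrete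

theorem exists_ne_zero_forall_mul_eq_intCast_of_fg {ι : Type*} [Finite ι]
    {W : Submodule ℤ (ι → ℚ)} (hW : W.FG) :
    ∃ N : ℤ, N ≠ 0 ∧ ∀ x ∈ W, ∀ i, ∃ m : ℤ, N * x i = m := by
  induction W, hW using Submodule.fg_induction with
  | singleton x =>
    obtain ⟨⟨N, hN⟩, hx⟩ := IsLocalization.exist_integer_multiples_of_finite (nonZeroDivisors ℤ) x
    refine ⟨N, nonZeroDivisors.ne_zero hN, fun y hy i => ?_⟩
    obtain ⟨c, rfl⟩ := Submodule.mem_span_singleton.1 hy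
    obtain ⟨m, hm⟩ := hx i
    have hNx : N * x i = m := by simpa [Algebra.smul_def] using hm.symm
    exact ⟨c * m, by rw [Pi.smul_apply, zsmul_eq_mul, mul_left_comm, hNx, Int.cast_mul]⟩
  | sup W₁ W₂ _ _ hW₁ hW₂ =>
    obtain ⟨N₁, hN₁, hW₁⟩ := hW₁
    obtain ⟨N₂, hN₂, hW₂⟩ := hW₂
    refine ⟨N₁ * N₂, mul_ne_zero hN₁ hN₂, fun x hx i => ?_⟩
    obtain ⟨y, hy, z, hz, rfl⟩ := Submodule.mem_sup.1 hx
    obtain ⟨k, hk⟩ := hW₁ y hy i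
    obtain ⟨l, hl⟩ := hW₂ z hz i
    refine ⟨N₂ * k + N₁ * l, ?_⟩
    push_cast
    rw [← hk, ← hl, Pi.add_apply]
    ring

theorem exists_pos_forall_eq_zero_of_fg {ι : Type*} [Finite ι] {W : Submodule ℤ (ι → ℚ)}
    (hW : W.FG) : ∃ ε : ℚ, 0 < ε ∧ ∀ x ∈ W, (∀ i, |x i| < ε) → x = 0 := by
  obtain ⟨N, hN, hint⟩ := exists_ne_zero_forall_mul_eq_intCast_of_fg hW
  have hNpos : (0 : ℚ) < |(N : ℚ)| := by positivity
  refine ⟨|(N : ℚ)|⁻¹, inv_pos.2 hNpos, fun x hx hlt => funext fun i => ?_⟩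
  obtain ⟨m, hm⟩ := hint x hx i
  have hm_lt : |(m : ℚ)| < 1 := by
    rw [← hm, abs_mul, ← lt_inv_mul_iff₀ hNpos, mul_one]
    exact hlt i
  have hm_zero : m = 0 := Int.abs_lt_one_iff.1 (by exact_mod_cast hm_lt)
  rw [hm_zero, Int.cast_zero] at hm
  exact (mul_eq_zero.1 hm).resolve_left (Int.cast_ne_zero.2 hN)

variable {n : ℕ}

/-- Multiplication by `M` as a `ℤ`-linear endomorphism of `ℚⁿ`, so that submodules of `ℚⁿ` over
the Noetherian ring `ℤ` can be moved by it. -/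
def mulEnd : Matrix (Fin n) (Fin n) ℚ →* Module.End ℤ (Fin n → ℚ) where
  toFun M := (mulHom M).toIntLinearMap
  map_one' := LinearMap.ext mulHom_one
  map_mul' M N := LinearMap.ext fun x => (mulHom_comp M N x).symm

theorem toIntSubmodule_zAdjoin (M : Matrix (Fin n) (Fin n) ℚ) :
    (zAdjoin M).toIntSubmodule =
      ⨆ k : ℕ, (intLattice n).toIntSubmodule.map (mulEnd M ^ k) := by
  simp only [zAdjoin, OrderIso.map_iSup, ← map_pow]
  rfl

theorem intLattice_fg (n : ℕ) : (intLattice n).toIntSubmodule.FG :=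
  Module.Finite.iff_fg.1 <|
    Module.Finite.range ((Int.castAddHom ℚ).compLeft (Fin n)).toIntLinearMap

theorem exists_pos_forall_mem_zAdjoin_inf_eq_zero {A : Matrix (Fin n) (Fin n) ℚ}
    (h : IsUnit A.det) :
    ∃ ε : ℚ, 0 < ε ∧ ∀ x ∈ zAdjoin A ⊓ zAdjoin A⁻¹, (∀ i, |x i| < ε) → x = 0 := by
  have : IsNoetherian ℤ (intLattice n).toIntSubmodule :=
    isNoetherian_of_fg_of_noetherian _ (intLattice_fg n)
  obtain ⟨m, hm⟩ := exists_iSup_inf_iSup_le_orbitSum (a := mulEnd A) (b := mulEnd A⁻¹)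
    (by rw [← map_mul, Matrix.mul_nonsing_inv A h, map_one]) (intLattice n).toIntSubmodule
  rw [← toIntSubmodule_zAdjoin, ← toIntSubmodule_zAdjoin] at hm
  obtain ⟨ε, hε, hzero⟩ := exists_pos_forall_eq_zero_of_fg (orbitSum_fg (intLattice_fg n) m)
  exact ⟨ε, hε, fun x hx => hzero x (hm hx)⟩

end Discrete

section Contraction

theorem tendsto_pow_zero_of_forall_mem_spectrum {𝒜 : Type*} [NormedRing 𝒜] [NormedAlgebra ℂ 𝒜]
    [CompleteSpace 𝒜] {b : 𝒜} (hb : ∀ z ∈ spectrum ℂ b, ‖z‖ < 1) :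
    Tendsto (fun k : ℕ => b ^ k) atTop (𝓝 0) := by
  rcases subsingleton_or_nontrivial 𝒜 with h | h
  · exact tendsto_const_nhds.congr fun k => Subsingleton.elim 0 _
  have hradius : spectralRadius ℂ b < (1 : ℝ≥0) :=
    spectrum.spectralRadius_lt_of_forall_lt b fun z hz => hb z hz
  obtain ⟨r, hr, hr1⟩ := ENNReal.lt_iff_exists_nnreal_btwn.1 hradius
  have hr1 : r < 1 := by exact_mod_cast hr1
  refine squeeze_zero_norm' ?_ (tendsto_pow_atTop_nhds_zero_of_lt_one r.2 hr1)
  filter_upwards [eventually_gt_atTop 0,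
    (spectrum.pow_nnnorm_pow_one_div_tendsto_nhds_spectralRadius b).eventually_lt_const hr]
    with k hk0 hk
  rw [one_div, ENNReal.rpow_inv_lt_iff (Nat.cast_pos.2 hk0), ENNReal.rpow_natCast] at hk
  exact_mod_cast hk.le

theorem norm_lt_one_of_mem_spectrum_inv {𝕜 R : Type*} [NormedField 𝕜] [Ring R] [Algebra 𝕜 R]
    {u : Rˣ} (hu : ∀ z ∈ spectrum 𝕜 (u : R), 1 < ‖z‖) :
    ∀ z ∈ spectrum 𝕜 (↑u⁻¹ : R), ‖z‖ < 1 := by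
  intro z hz
  have hz0 : z ≠ 0 := spectrum.ne_zero_of_mem_of_unit hz
  have hz' : z⁻¹ ∈ spectrum 𝕜 (u : R) := by
    simpa using (spectrum.inv_mem_iff (r := Units.mk0 z hz0) (a := u⁻¹)).1 hz
  have := hu _ hz'
  rw [norm_inv] at this
  exact (one_lt_inv₀ (norm_pos_iff.2 hz0)).1 this

variable {n : ℕ} {A : Matrix (Fin n) (Fin n) ℚ}

open scoped Matrix.Norms.L2Operator

theorem IsExpanding.tendsto_inv_pow (hA : IsExpanding A) :
    Tendsto (fun k : ℕ => A⁻¹.map (algebraMap ℚ ℝ) ^ k) atTop (𝓝 0) := by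
  let u : (Matrix (Fin n) (Fin n) ℂ)ˣ :=
    Units.map (algebraMap ℚ ℂ).mapMatrix.toMonoidHom (A.nonsingInvUnit hA.isUnit_det)
  have hcomplex : Tendsto (fun k : ℕ => A⁻¹.map (algebraMap ℚ ℂ) ^ k) atTop (𝓝 0) :=
    tendsto_pow_zero_of_forall_mem_spectrum (norm_lt_one_of_mem_spectrum_inv (u := u) hA)
  have hre : Continuous fun M : Matrix (Fin n) (Fin n) ℂ => M.map Complex.re :=
    continuous_id.matrix_map Complex.continuous_re
  have hreal := (hre.tendsto 0).comp hcomplex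
  rw [Matrix.map_zero _ Complex.zero_re] at hreal
  refine hreal.congr fun k => ?_
  ext i j
  rw [Function.comp_apply, ← Matrix.map_pow, ← Matrix.map_pow]
  exact Complex.ratCast_re _

theorem IsExpanding.exists_nnnorm_inv_pow_lt_one (hA : IsExpanding A) :
    ∃ N ≠ 0, ‖A⁻¹.map (algebraMap ℚ ℝ) ^ N‖₊ < 1 := by
  have hnorm := hA.tendsto_inv_pow.nnnorm
  rw [nnnorm_zero] at hnorm
  obtain ⟨N, hN, hN0⟩ :=
    ((hnorm.eventually_lt_const one_pos).and (eventually_ne_atTop 0)).exists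
  exact ⟨N, hN0, hN⟩

/-- Multiplication by an invertible rational matrix as an automorphism of `ℝⁿ`. -/
noncomputable def euclideanEquiv (h : IsUnit A.det) :
    EuclideanSpace ℝ (Fin n) ≃L[ℝ] EuclideanSpace ℝ (Fin n) :=
  ContinuousLinearEquiv.unitsEquiv ℝ _ <| Units.map
    ((Matrix.toEuclideanCLM (n := Fin n) (𝕜 := ℝ)).toMonoidHom.comp
      (algebraMap ℚ ℝ).mapMatrix.toMonoidHom) (A.nonsingInvUnit h)

theorem lipschitzWith_euclideanEquiv_symm_iterate (h : IsUnit A.det) (k : ℕ) :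
    LipschitzWith ‖A⁻¹.map (algebraMap ℚ ℝ) ^ k‖₊ (euclideanEquiv h).symm^[k] := by
  have hk : (euclideanEquiv h).symm^[k] =
      Matrix.toEuclideanCLM (n := Fin n) (𝕜 := ℝ) (A⁻¹.map (algebraMap ℚ ℝ) ^ k) := by
    rw [map_pow, FunLike.coe_pow_eq_iterate]
    rfl
  rw [hk, Matrix.cstar_nnnorm_def]
  exact ContinuousLinearMap.lipschitz _

end Contraction

section Series

variable {n : ℕ} (A : Matrix (Fin n) (Fin n) ℚ) (hA : IsExpanding A)

theorem mulHom_inv_mem_zLaurent (h : IsUnit A.det) {y : Fin n → ℚ} (hy : y ∈ zLaurent A) :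
    mulHom A⁻¹ y ∈ zLaurent A := by
  suffices hmap : (zLaurent A).map (mulHom A⁻¹) ≤ zLaurent A from hmap ⟨y, hy, rfl⟩
  rw [zLaurent, AddSubgroup.map_iSup]
  refine iSup_le fun k => ?_
  rintro _ ⟨_, ⟨x, hx, rfl⟩, rfl⟩
  refine AddSubgroup.mem_iSup_of_mem (-1 + k) ⟨x, hx, ?_⟩
  rw [mulHom_comp, Matrix.zpow_add h, Matrix.zpow_neg_one]

theorem bAbs_mulHom_inv_le (h : IsUnit A.det) (y : Fin n → ℚ) :
    bAbs A (mulHom A⁻¹ y) ≤ 2⁻¹ * bAbs A y := by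
  by_cases hj : ∃ m, IsJump A (mulHom A⁻¹ y) m
  · obtain ⟨m, hm⟩ := hj
    have two_le : (2 : ℝ) ≤ residueCard A⁻¹ := by exact_mod_cast two_le_of_isJump h hm
    rw [le_inv_mul_iff₀ two_pos]
    calc 2 * bAbs A (mulHom A⁻¹ y) ≤ residueCard A⁻¹ * bAbs A (mulHom A⁻¹ y) :=
          mul_le_mul_of_nonneg_right two_le (bAbs_nonneg _)
      _ = bAbs A y := by
          rw [← bAbs_mul h, mulHom_comp, Matrix.mul_nonsing_inv A h, mulHom_one]
  · rw [bAbs_of_no_jump hj]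
    exact mul_nonneg (by norm_num) (bAbs_nonneg y)

/-- Multiplication by `A` on `ℤⁿ(B)` as an automorphism, with inverse the multiplication by
`B = A⁻¹`. -/
noncomputable def laurentEquiv : Laurent A hA ≃+ Laurent A hA where
  __ := laurentMul A hA
  invFun y := ⟨mulHom A⁻¹ y.1, mulHom_inv_mem_zLaurent A hA.isUnit_det y.2⟩
  left_inv y := Subtype.ext <| by
    change mulHom A⁻¹ (mulHom A y.1) = y.1
    rw [mulHom_comp, Matrix.nonsing_inv_mul A hA.isUnit_det, mulHom_one]
  right_inv y := Subtype.ext <| by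
    change mulHom A (mulHom A⁻¹ y.1) = y.1
    rw [mulHom_comp, Matrix.mul_nonsing_inv A hA.isUnit_det, mulHom_one]

theorem lipschitzWith_laurentEquiv_symm : LipschitzWith 2⁻¹ (laurentEquiv A hA).symm :=
  AddMonoidHomClass.lipschitz_of_bound_nnnorm _ _ fun y => bAbs_mulHom_inv_le A hA.isUnit_det y.1

theorem completion_map_leftInverse {X Y : Type*} [UniformSpace X] [UniformSpace Y] {f : X → Y}
    {g : Y → X} (hf : UniformContinuous f) (hg : UniformContinuous g)
    (h : Function.LeftInverse f g) :
    Function.LeftInverse (UniformSpace.Completion.map f) (UniformSpace.Completion.map g) := by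
  rw [Function.leftInverse_iff_comp, UniformSpace.Completion.map_comp hf hg, h.comp_eq_id,
    UniformSpace.Completion.map_id]

/-- Multiplication by `A` on `ℤⁿ((B))` as an automorphism. -/
noncomputable def seriesEquiv : BSeries A hA ≃+ BSeries A hA where
  __ := seriesMul A hA
  invFun := UniformSpace.Completion.map (laurentEquiv A hA).symm
  left_inv := completion_map_leftInverse (lipschitzWith_laurentEquiv_symm A hA).uniformContinuous
    (uniformContinuous_addMonoidHom_of_continuous (laurentMul_continuous A hA))
    (laurentEquiv A hA).symm_apply_apply
  right_inv := completion_map_leftInverse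
    (uniformContinuous_addMonoidHom_of_continuous (laurentMul_continuous A hA))
    (lipschitzWith_laurentEquiv_symm A hA).uniformContinuous (laurentEquiv A hA).apply_symm_apply

theorem lipschitzWith_seriesEquiv_symm : LipschitzWith 2⁻¹ (seriesEquiv A hA).symm :=
  (lipschitzWith_laurentEquiv_symm A hA).completion_map

/-- Multiplication by `A` on the representation space as an automorphism. -/
noncomputable def repEquiv : RepSpace A hA ≃+ RepSpace A hA :=
  (euclideanEquiv hA.isUnit_det).toAddEquiv.prodCongr (seriesEquiv A hA)

theorem continuous_repEquiv_symm : Continuous (repEquiv A hA).symm :=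
  (euclideanEquiv hA.isUnit_det).symm.continuous.prodMap
    (lipschitzWith_seriesEquiv_symm A hA).continuous

theorem lipschitzWith_prodMap {α β γ δ : Type*} [PseudoEMetricSpace α] [PseudoEMetricSpace β]
    [PseudoEMetricSpace γ] [PseudoEMetricSpace δ] {K L : ℝ≥0} {f : α → β} {g : γ → δ}
    (hf : LipschitzWith K f) (hg : LipschitzWith L g) :
    LipschitzWith (max K L) (Prod.map f g) := by
  rw [← mul_one K, ← mul_one L]
  exact (hf.comp LipschitzWith.prod_fst).prodMk (hg.comp LipschitzWith.prod_snd)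

open scoped Matrix.Norms.L2Operator in
theorem exists_contractingWith_repEquiv_symm_iterate :
    ∃ K k, ContractingWith K (repEquiv A hA).symm^[k] := by
  obtain ⟨N, hN0, hN⟩ := hA.exists_nnnorm_inv_pow_lt_one
  refine ⟨_, N, max_lt hN (pow_lt_one₀ zero_le two_inv_lt_one hN0), ?_⟩
  have hiter : (repEquiv A hA).symm^[N] =
      Prod.map (euclideanEquiv hA.isUnit_det).symm^[N] (seriesEquiv A hA).symm^[N] :=
    Prod.map_iterate _ _ N
  rw [hiter]
  exact lipschitzWith_prodMap (lipschitzWith_euclideanEquiv_symm_iterate _ N)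
    ((lipschitzWith_seriesEquiv_symm A hA).iterate N)

end Series

section DigitLattice

variable {n : ℕ} (A : Matrix (Fin n) (Fin n) ℚ) (hA : IsExpanding A)

/-- The inclusion of `ℤⁿ[A]` into `ℤⁿ(B)`, which carries the `B`-adic metric. -/
noncomputable def toLaurent : zAdjoin A →+ Laurent A hA :=
  AddSubgroup.inclusion (zAdjoin_le_zLaurent A)

/-- The diagonal embedding of `ℤⁿ[A]` as a group homomorphism; its range is the lattice of
translates of the tile. -/
noncomputable def digitHom : zAdjoin A →+ RepSpace A hA :=
  AddMonoidHom.mk' (digitEmb A hA) fun x y =>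
    Prod.ext (PiLp.ext fun _ => Rat.cast_add _ _)
      (UniformSpace.Completion.coe_add (toLaurent A hA x) (toLaurent A hA y))

theorem repMul_digitEmb (x : zAdjoin A) :
    repMul A hA (digitEmb A hA x) =
      digitEmb A hA ⟨mulHom A x, map_zAdjoin_le A ⟨x, x.2, rfl⟩⟩ :=
  Prod.ext (PiLp.ext fun i => ((algebraMap ℚ ℝ).map_mulVec A x i).symm)
    (AddMonoidHom.completion_coe _ (laurentMul_continuous A hA) _)

theorem norm_digitEmb_snd (x : zAdjoin A) : ‖(digitEmb A hA x).2‖ = bAbs A x.1 :=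
  UniformSpace.Completion.norm_coe (toLaurent A hA x)

theorem bAbs_le_one_iff {A : Matrix (Fin n) (Fin n) ℚ} (h : IsUnit A.det) {y : Fin n → ℚ}
    (hy : y ∈ zLaurent A) : bAbs A y ≤ 1 ↔ y ∈ zAdjoin A⁻¹ := by
  simpa [filt_zero] using bAbs_le_iff h hy 0

theorem isClosed_range_digitEmb : IsClosed (Set.range (digitEmb A hA)) := by
  obtain ⟨ε, hε, hzero⟩ := exists_pos_forall_mem_zAdjoin_inf_eq_zero hA.isUnit_det
  have eq_zero_of_small (x : zAdjoin A) (hx : ‖digitEmb A hA x‖ < min (ε : ℝ) 1) : x = 0 := by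
    have hadic : bAbs A x.1 ≤ 1 := norm_digitEmb_snd A hA x ▸
      (norm_snd_le _).trans (hx.le.trans (min_le_right _ _))
    have hreal (i : Fin n) : |((x.1 i : ℚ) : ℝ)| < ε :=
      (PiLp.norm_apply_le (digitEmb A hA x).1 i).trans_lt <|
        (norm_fst_le _).trans_lt (hx.trans_le (min_le_left _ _))
    refine Subtype.ext (hzero x ⟨x.2, ?_⟩ fun i => ?_)
    · exact (bAbs_le_one_iff hA.isUnit_det (zAdjoin_le_zLaurent A x.2)).1 hadic
    · exact_mod_cast hreal i
  have : DiscreteTopology (digitHom A hA).range := by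
    refine discreteTopology_of_isOpen_singleton_zero (Metric.isOpen_singleton_iff.2
      ⟨min (ε : ℝ) 1, lt_min (by exact_mod_cast hε) one_pos, ?_⟩)
    rintro ⟨_, x, rfl⟩ hx
    rw [dist_zero_right] at hx
    rw [Subtype.ext_iff]
    exact (congrArg (digitHom A hA) (eq_zero_of_small x hx)).trans (map_zero _)
  exact AddSubgroup.isClosed_of_discrete (H := (digitHom A hA).range)

theorem zLaurent_le_sup {A : Matrix (Fin n) (Fin n) ℚ} (h : IsUnit A.det) :
    zLaurent A ≤ zAdjoin A ⊔ zAdjoin A⁻¹ := by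
  refine iSup_le fun k => ?_
  rcases Int.eq_nat_or_neg k with ⟨j, rfl | rfl⟩
  · rw [zpow_natCast]
    exact (le_iSup (fun k : ℕ => (intLattice n).map (mulHom (A ^ k))) j).trans le_sup_left
  · rw [← Matrix.inv_zpow' h, zpow_natCast]
    exact (le_iSup (fun k : ℕ => (intLattice n).map (mulHom (A⁻¹ ^ k))) j).trans le_sup_right

theorem exists_intCast_dist_le {ι : Type*} [Fintype ι] (x : EuclideanSpace ℝ ι) :
    ∃ v : ι → ℤ, dist x (WithLp.toLp 2 fun i => (v i : ℝ)) ≤ √(Fintype.card ι) := by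
  refine ⟨fun i => ⌊x i⌋, ?_⟩
  rw [EuclideanSpace.dist_eq]
  refine Real.sqrt_le_sqrt ?_
  calc ∑ i, dist (x i) (⌊x i⌋ : ℝ) ^ 2 ≤ ∑ _i : ι, (1 : ℝ) := by
        refine Finset.sum_le_sum fun i _ => pow_le_one₀ dist_nonneg ?_
        rw [Real.dist_eq, Int.self_sub_floor, Int.abs_fract]
        exact (Int.fract_lt_one _).le
    _ = Fintype.card ι := by simp

theorem exists_dist_digitEmb_snd_le (y : BSeries A hA) :
    ∃ z : zAdjoin A, dist y (digitEmb A hA z).2 ≤ 2 := by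
  obtain ⟨y', hy'⟩ := UniformSpace.Completion.denseRange_coe.exists_dist_lt y one_pos
  obtain ⟨z, hz, w, hw, hzw⟩ := AddSubgroup.mem_sup.1 (zLaurent_le_sup hA.isUnit_det y'.2)
  have hw_sub : y'.1 - z ∈ zAdjoin A⁻¹ := by rwa [← hzw, add_sub_cancel_left]
  have hdist : dist y' (toLaurent A hA ⟨z, hz⟩) ≤ 1 := by
    rw [dist_eq_norm]
    exact (bAbs_le_one_iff hA.isUnit_det (y' - toLaurent A hA ⟨z, hz⟩).2).2 hw_sub
  rw [← UniformSpace.Completion.dist_eq] at hdist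
  refine ⟨⟨z, hz⟩, (dist_triangle _ _ _).trans ((add_le_add hy'.le hdist).trans_eq ?_)⟩
  norm_num

theorem exists_dist_digitEmb_le (p : RepSpace A hA) :
    ∃ x ∈ Set.range (digitEmb A hA), dist p x ≤ max √n 3 := by
  obtain ⟨z, hz⟩ := exists_dist_digitEmb_snd_le A hA p.2
  obtain ⟨v, hv⟩ := exists_intCast_dist_le (p.1 - (digitEmb A hA z).1)
  let u : zAdjoin A := ⟨fun i => v i, intLattice_le_zAdjoin A ⟨v, rfl⟩⟩
  have hu_fst : (digitEmb A hA u).1 = WithLp.toLp 2 fun i => (v i : ℝ) :=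
    PiLp.ext fun i => Rat.cast_intCast (v i)
  have hu_snd : ‖(digitEmb A hA u).2‖ ≤ 1 := by
    rw [norm_digitEmb_snd, bAbs_le_one_iff hA.isUnit_det (zAdjoin_le_zLaurent A u.2)]
    exact intLattice_le_zAdjoin A⁻¹ ⟨v, rfl⟩
  refine ⟨digitEmb A hA z + digitEmb A hA u, ⟨z + u, map_add (digitHom A hA) z u⟩,
    max_le_max ?_ ?_⟩
  · rw [Prod.fst_add, hu_fst, dist_eq_norm, ← sub_sub, ← dist_eq_norm]
    simpa only [Fintype.card_fin] using hv
  · rw [Prod.snd_add, dist_eq_norm, ← sub_sub]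
    rw [dist_eq_norm] at hz
    exact (norm_sub_le _ _).trans ((add_le_add hz hu_snd).trans_eq (by norm_num))

theorem range_digitEmb_subset {D : Finset (zAdjoin A)}
    (hD : ∀ c : zAdjoin A ⧸ mulSub A, ∃ d ∈ D, QuotientAddGroup.mk d = c) :
    Set.range (digitEmb A hA) ⊆
      digitEmb A hA '' D + repMul A hA '' Set.range (digitEmb A hA) := by
  rintro _ ⟨x, rfl⟩
  obtain ⟨d, hd, hdx⟩ := hD x
  obtain ⟨y, hy, hyx⟩ := QuotientAddGroup.eq.1 hdx
  refine Set.mem_add.2 ⟨_, ⟨d, hd, rfl⟩, _, ⟨_, ⟨⟨y, hy⟩, rfl⟩, rfl⟩, ?_⟩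
  rw [repMul_digitEmb]
  refine (map_add (digitHom A hA) _ _).symm.trans (congrArg (digitHom A hA) (Subtype.ext ?_))
  exact (congrArg (d.1 + ·) hyx).trans (add_neg_cancel_left d.1 x.1)

end DigitLattice

section RepMeasure

variable {n : ℕ} (A : Matrix (Fin n) (Fin n) ℚ) (hA : IsExpanding A)

instance : Countable (Laurent A hA) := inferInstanceAs (Countable (zLaurent A))

instance : SecondCountableTopology (BSeries A hA) := UniformSpace.secondCountable_of_separable _

instance : LocallyCompactSpace (BSeries A hA) :=
  (integralCompacts A hA).locallyCompactSpace_of_addGroup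

instance : (seriesMeasure A hA).IsAddHaarMeasure :=
  inferInstanceAs (Measure.addHaarMeasure (integralCompacts A hA)).IsAddHaarMeasure

instance : (repMeasure A hA).IsAddHaarMeasure :=
  inferInstanceAs (Measure.prod _ (seriesMeasure A hA)).IsAddHaarMeasure

end RepMeasure

end RationalTile

open RationalTile TopologicalSpace in
open scoped Pointwise in
theorem mainTheorem6_general {n : ℕ} (A : Matrix (Fin n) (Fin n) ℚ) (hA : IsExpanding A)
    (D : Finset (zAdjoin A))
    (hD : ∀ c : zAdjoin A ⧸ mulSub A, ∃ d ∈ D, QuotientAddGroup.mk d = c) :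
    ∃ F : Set (RepSpace A hA),
      (IsSelfAffineSet A hA D F ∧ ∀ F', IsSelfAffineSet A hA D F' → F' = F) ∧
      0 < repMeasure A hA F := by
  obtain ⟨K, k, hK⟩ := exists_contractingWith_repEquiv_symm_iterate A hA
  let Φ : NonemptyCompacts (RepSpace A hA) :=
    { carrier := digitEmb A hA '' D
      isCompact' := (D.finite_toSet.image _).isCompact
      nonempty' := let ⟨d, hd, _⟩ := hD 0; ⟨_, d, hd, rfl⟩ }
  have iUnion_eq (F : Set (RepSpace A hA)) :
      ⋃ d ∈ D, (· + digitEmb A hA d) '' F = F + Φ := by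
    rw [← Set.iUnion_add_right_image]
    exact (Set.biUnion_image (s := (D : Set (zAdjoin A))) (f := digitEmb A hA)
      (g := fun a => (· + a) '' F)).symm
  obtain ⟨F, hF, hunique⟩ :=
    existsUnique_image_eq_add (repEquiv A hA) (continuous_repEquiv_symm A hA) hK Φ
  refine ⟨F, ⟨⟨F.nonempty, F.isCompact, hF.trans (iUnion_eq F).symm⟩, fun F' hF' => ?_⟩, ?_⟩
  · exact congrArg SetLike.coe <|
      hunique ⟨⟨F', hF'.isCompact⟩, hF'.nonempty⟩ (hF'.set_eq.trans (iUnion_eq F'))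
  · exact measure_pos_of_add_eq_univ (Set.countable_range (digitEmb A hA)) <|
      add_eq_univ_of_image_eq_add (repEquiv A hA) hK F.isCompact F.nonempty hF
        (isClosed_range_digitEmb A hA) (range_digitEmb_subset A hA hD)
        (exists_dist_digitEmb_le A hA)

theorem mainTheorem6 (n : ℕ) (A : Matrix (Fin n) (Fin n) ℚ)
    (D : Finset (RationalTile.zAdjoin A)) (hD : RationalTile.IsStandardDigitSystem A D) :
    ∃ F : Set (RationalTile.RepSpace A hD.expanding),
      (RationalTile.IsSelfAffineSet A hD.expanding D F ∧
        ∀ F', RationalTile.IsSelfAffineSet A hD.expanding D F' → F' = F) ∧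
      0 < RationalTile.repMeasure A hD.expanding F :=
  mainTheorem6_general A hD.expanding D fun c => (hD.complete c).exists
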